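/- Let $\mathcal{H}$ be a complex Hilbert space, let $\boldsymbol{B}(\mathcal{H})$ be the algebra of bounded linear operators on $\mathcal{H}$, and let $\mathfrak{B}(\mathbb{R}_+)$ be the Borel $\sigma$-algebra of $\mathbb{R}_+=[0,\infty)$. Let $F\colon \mathfrak{B}(\mathbb{R}_+)\to\boldsymbol{B}(\mathcal{H})$ be a semispectral measure, that is, $\langle F(\cdot)h,h\rangle$ is a positive measure for every $h\in\mathcal{H}$, and $F(\mathbb{R}_+)=I_{\mathcal{H}}$. Assume that the closed support of $F$ is compact. For a Borel function $f\colon\mathbb{R}_+\to\mathbb{C}$ such that $\int_{\mathbb{R}_+}|f(x)|\,\langle F(\mathrm{d}x)h,h\rangle<\infty$ for all $h\in\mathcal{H}$, denote by $\int_{\mathbb{R}_+} f\,\mathrm{d}F$ the unique operator in $\boldsymbol{B}(\mathcal{H})$ such that $$\Big\langle \int_{\mathbb{R}_+} f\,\mathrm{d}F\,h,h\Big\rangle=\int_{\mathbb{R}_+} f(x)\,\langle F(\mathrm{d}x)h,h\rangle,\qquad h\in\mathcal{H}.$$ Let $p$ be a positive real number with $p\neq 1$. Assume that $$\Big(\int_{\mathbb{R}_+}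 x\,F(\mathrm{d}x)\Big)^{p}=\int_{\mathbb{R}_+} x^{p}\,F(\mathrm{d}x),$$ where the power on the left is taken in the sense of the functional calculus for positive operators. Then $F$ is a spectral measure, that is, $F(\Delta)$ is an orthogonal projection for every $\Delta\in\mathfrak{B}(\mathbb{R}_+)$. -/

import Mathlib

open MeasureTheory Filter Topology

/-- A semispectral measure on the measurable space `X` with values in the bounded operators on the
complex Hilbert space `H`: `F s` is prescribed for measurable `s` (the values on non-measurable sets
play no role), the set function `⟨F(·)h, h⟩` is a positive measure for every `h`, and
`F X` is the identity operator. -/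
structure SemispectralMeasure (X : Type*) [MeasurableSpace X] (H : Type*)
    [NormedAddCommGroup H] [InnerProductSpace ℂ H] [CompleteSpace H] where
  /-- The underlying operator-valued set function. -/
  toFun : Set X → (H →L[ℂ] H)
  isPositive' : ∀ s, MeasurableSet s → (toFun s).IsPositive
  hasSum_iUnion' : ∀ s : ℕ → Set X, (∀ n, MeasurableSet (s n)) →
    Pairwise (Function.onFun Disjoint s) →
    ∀ h : H, HasSum (fun n => inner ℂ h (toFun (s n) h)) (inner ℂ h (toFun (⋃ n, s n) h))
  univ' : toFun Set.univ = 1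

namespace SemispectralMeasure

variable {X : Type*} [MeasurableSpace X] {H : Type*}
  [NormedAddCommGroup H] [InnerProductSpace ℂ H] [CompleteSpace H]

instance : CoeFun (SemispectralMeasure X H) (fun _ => Set X → (H →L[ℂ] H)) := ⟨toFun⟩

/-- `F` is a spectral measure if all its values (on measurable sets) are orthogonal projections,
i.e. selfadjoint idempotents. -/
def IsSpectral (F : SemispectralMeasure X H) : Prop :=
  ∀ s, MeasurableSet s → IsStarProjection (F s)

/-- The closed support of `F`: the points all of whose open neighbourhoods are non-null. -/
def support [TopologicalSpace X] (F : SemispectralMeasure X H) : Set X :=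
  {x | ∀ U : Set X, IsOpen U → x ∈ U → F U ≠ 0}

/-- `F` has compact support. -/
def HasCompactSupport [TopologicalSpace X] (F : SemispectralMeasure X H) : Prop :=
  IsCompact F.support

theorem inner_empty (F : SemispectralMeasure X H) (h : H) : inner ℂ h (F ∅ h) = (0 : ℂ) := by
  have := (F.hasSum_iUnion' (fun _ => ∅) (fun _ => MeasurableSet.empty)
    (fun _ _ _ => by simp [Function.onFun]) h).summable
  simpa using (summable_const_iff _).1 this

/-- The positive measure `s ↦ ⟨F(s)h, h⟩`. -/
noncomputable def scalarMeasure (F : SemispectralMeasure X H) (h : H) : Measure X :=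
  Measure.ofMeasurable (fun s _ => ENNReal.ofReal (inner ℂ h (F s h) : ℂ).re)
    (by simp [F.inner_empty h])
    (by
      intro s hs hd
      have H1 := Complex.hasSum_re (F.hasSum_iUnion' s hs hd h)
      rw [← H1.tsum_eq]
      exact ENNReal.ofReal_tsum_of_nonneg
        (fun n => (F.isPositive' _ (hs n)).re_inner_nonneg_right h) H1.summable)

theorem scalarMeasure_apply (F : SemispectralMeasure X H) (h : H) {s : Set X}
    (hs : MeasurableSet s) :
    F.scalarMeasure h s = ENNReal.ofReal (inner ℂ h (F s h) : ℂ).re :=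
  Measure.ofMeasurable_apply s hs

instance (F : SemispectralMeasure X H) (h : H) : IsFiniteMeasure (F.scalarMeasure h) :=
  ⟨by rw [F.scalarMeasure_apply h MeasurableSet.univ]; exact ENNReal.ofReal_lt_top⟩

theorem scalarMeasure_real (F : SemispectralMeasure X H) (h : H) {s : Set X}
    (hs : MeasurableSet s) :
    (((F.scalarMeasure h).real s : ℝ) : ℂ) = inner ℂ h (F s h) := by
  have hp := F.isPositive' s hs
  rw [Measure.real, F.scalarMeasure_apply h hs,
    ENNReal.toReal_ofReal (show 0 ≤ (inner ℂ h (F s h) : ℂ).re from hp.re_inner_nonneg_right h)]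
  have h0 := hp.inner_nonneg_right h
  rw [Complex.le_def] at h0
  exact Complex.ext rfl (by simpa using h0.2)

/-- `f ∈ L¹(F)`: the function `f` is measurable and `∫ |f(x)| ⟨F(dx)h, h⟩ < ∞` for all `h`. -/
def MemL1 (F : SemispectralMeasure X H) (f : X → ℂ) : Prop :=
  Measurable f ∧ ∀ h : H, Integrable f (F.scalarMeasure h)

/-- An auxiliary fact: if all quadratic forms `⟨T n h, h⟩` converge, then the sequence `T n`
of bounded operators converges weakly to a bounded operator. -/
theorem exists_weak_limit (T : ℕ → H →L[ℂ] H) (q : H → ℂ)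
    (hq : ∀ h, Tendsto (fun n => inner ℂ h (T n h)) atTop (𝓝 (q h))) :
    ∃ S : H →L[ℂ] H, ∀ h, inner ℂ h (S h) = q h := by
  have hq' : ∀ h, Tendsto (fun n => inner ℂ (T n h) h) atTop (𝓝 (starRingEnd ℂ (q h))) := by
    intro h
    exact ((Complex.continuous_conj.tendsto _).comp (hq h)).congr
      (fun n => inner_conj_symm _ _)
  have hconv : ∀ y x, ∃ c, Tendsto (fun n => inner ℂ (T n y) x) atTop (𝓝 c) := by
    intro y x
    have h1 := (((((hq' (y + x)).sub (hq' (y - x))).sub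
      ((hq' (y + Complex.I • x)).const_mul Complex.I)).add
      ((hq' (y - Complex.I • x)).const_mul Complex.I)).div_const 4)
    exact ⟨_, h1.congr (fun n => (inner_map_polarization' (T n : H →ₗ[ℂ] H) y x).symm)⟩
  choose b hb using hconv
  have hvec : ∀ y, ∃ v : H, ∀ x, inner ℂ v x = b y x := by
    intro y
    let ℓ : H →L[ℂ] ℂ := continuousLinearMapOfTendsto (fun n => innerSL ℂ (T n y))
      (f := b y) (tendsto_pi_nhds.2 (fun x => by simpa using hb y x))
    refine ⟨(InnerProductSpace.toDual ℂ H).symm ℓ, fun x => ?_⟩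
    rw [InnerProductSpace.toDual_symm_apply]
    rfl
  choose S hS using hvec
  have hT : ∀ y x, Tendsto (fun n => inner ℂ (T n y) x) atTop (𝓝 (inner ℂ (S y) x)) := by
    intro y x
    rw [hS]
    exact hb y x
  have hbdd : ∃ C, ∀ n, ‖T n‖ ≤ C := by
    refine banach_steinhaus (fun y => ?_)
    obtain ⟨C, hC⟩ := banach_steinhaus (g := fun n => innerSL ℂ (T n y)) (fun x => by
      obtain ⟨C, hC⟩ := (hT y x).norm.bddAbove_range
      exact ⟨C, fun n => by simpa using hC ⟨n, rfl⟩⟩)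
    exact ⟨C, fun n => by simpa using hC n⟩
  obtain ⟨C, hC⟩ := hbdd
  let L : H →ₗ[ℂ] H :=
    { toFun := S
      map_add' := fun y z => by
        refine ext_inner_right ℂ (fun x => ?_)
        refine tendsto_nhds_unique (hT (y + z) x) ?_
        simpa [inner_add_left] using (hT y x).add (hT z x)
      map_smul' := fun c y => by
        refine ext_inner_right ℂ (fun x => ?_)
        refine tendsto_nhds_unique (hT (c • y) x) ?_
        simpa [inner_smul_left, mul_comm] using (hT y x).const_mul (starRingEnd ℂ c) }
  refine ⟨L.mkContinuous C (fun y => ?_), fun h => ?_⟩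
  · by_cases h0 : S y = 0
    · change ‖S y‖ ≤ _
      rw [h0, norm_zero]
      exact mul_nonneg ((norm_nonneg _).trans (hC 0)) (norm_nonneg _)
    · have h1 : ‖inner ℂ (S y) (S y)‖ ≤ C * ‖y‖ * ‖S y‖ := by
        refine le_of_tendsto (hT y (S y)).norm (Eventually.of_forall fun n => ?_)
        refine (norm_inner_le_norm _ _).trans ?_
        gcongr
        exact (T n).le_of_opNorm_le (hC n) y
      have h2 : ‖inner ℂ (S y) (S y)‖ = ‖S y‖ * ‖S y‖ := by
        rw [inner_self_eq_norm_sq_to_K]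
        simp [sq]
      rw [h2] at h1
      exact le_of_mul_le_mul_right h1 (norm_pos_iff.2 h0)
  · have h1 : inner ℂ (S h) h = starRingEnd ℂ (q h) := tendsto_nhds_unique (hT h h) (hq' h)
    change inner ℂ h (S h) = q h
    rw [← inner_conj_symm, h1, Complex.conj_conj]

/-- For every `f ∈ L¹(F)` there is a unique bounded operator `T` with
`⟨T h, h⟩ = ∫ f(x) ⟨F(dx)h, h⟩` for all `h`. -/
theorem existsUnique_integral (F : SemispectralMeasure X H) {f : X → ℂ} (hf : F.MemL1 f) :
    ∃! T : H →L[ℂ] H, ∀ h : H, inner ℂ h (T h) = ∫ x, f x ∂(F.scalarMeasure h) := by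
  have hex : ∃ T : H →L[ℂ] H, ∀ h : H, inner ℂ h (T h) = ∫ x, f x ∂(F.scalarMeasure h) := by
    let φ : ℕ → SimpleFunc X ℂ := SimpleFunc.approxOn f hf.1 Set.univ 0 (Set.mem_univ _)
    refine exists_weak_limit (fun n => ∑ c ∈ (φ n).range, c • F (φ n ⁻¹' {c})) _ (fun h => ?_)
    refine (tendsto_integral_approxOn_of_measurable (hf.2 h) hf.1 (s := Set.univ) (by simp)
      (Set.mem_univ 0) (integrable_const _)).congr (fun n => ?_)
    rw [SimpleFunc.integral_eq_integral _ (SimpleFunc.integrable_of_isFiniteMeasure _),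
      SimpleFunc.integral_eq_sum _ (SimpleFunc.integrable_of_isFiniteMeasure _)]
    simp only [_root_.sum_apply, _root_.smul_apply, inner_sum,
      inner_smul_right]
    refine Finset.sum_congr rfl (fun c _ => ?_)
    rw [← F.scalarMeasure_real h (SimpleFunc.measurableSet_preimage _ _), Complex.real_smul,
      mul_comm]
  obtain ⟨T, hT⟩ := hex
  refine ⟨T, hT, fun S hS => ?_⟩
  have : (S : H →ₗ[ℂ] H) = T := by
    refine (ext_inner_map _ _).1 (fun h => ?_)
    rw [← inner_conj_symm, ← inner_conj_symm (_ : H) h]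
    exact congrArg _ ((hS h).trans (hT h).symm)
  exact ContinuousLinearMap.coe_injective this

open Classical in
/-- The operator `∫ f dF`, that is, the unique bounded operator `T` such that
`⟨T h, h⟩ = ∫ f(x) ⟨F(dx)h, h⟩` for all `h`, for `f ∈ L¹(F)`
(and by convention `0` for `f ∉ L¹(F)`). -/
noncomputable def integral (F : SemispectralMeasure X H) (f : X → ℂ) : H →L[ℂ] H :=
  if hf : F.MemL1 f then (F.existsUnique_integral hf).choose else 0

end SemispectralMeasure

/-! Let `0 < p < 1` and `A = ∫ x dF`. A Cauchy–Schwarz inequality for `F` gives the resolvent form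
of Jensen's inequality, `(t + A)⁻¹ ≤ ∫ (t + x)⁻¹ dF` (`cfcFunctional_resolventMap_le`). Up to a
constant factor, `x ^ p` is the integral over `t > 0` of `t ^ (p - 1) - t ^ p * (t + x)⁻¹`. Equality
for `x ^ p` therefore forces, for each vector `h`, equality of the resolvent forms at `h` for almost
every `t`. Equality for arbitrarily large `t` yields equality of all moments by expansion at `t =
∞`, and Weierstrass then gives `f(A) = ∫ f dF` for every continuous `f` (`integral_eq_inner_cfc`).
The right side thus inherits multiplicativity from the functional calculus; it passes to indicators
of closed sets by monotone approximation and to Borel sets by a π-λ argument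
(`isSpectral_of_integral_eq_cfc`). For `p > 1`, the image of `F` under `x ↦ x ^ p` satisfies the
hypothesis with exponent `p⁻¹ < 1`. -/

/-! ### Functionals on `C([0, M])` tested on resolvent functions. -/

/-- The function `x ↦ (t + x)⁻¹` on `[0, M]`, for `t > 0`. -/
noncomputable def resolventMap (M t : ℝ) : C(Set.Icc (0 : ℝ) M, ℝ) :=
  -- The fallback `0` is used only when the function is not continuous, so `t` may range over all of
  -- `ℝ` without carrying a proof of positivity.
  ContinuousMap.mkD (fun x => (t + (x : ℝ))⁻¹) 0

theorem resolventMap_apply {M t : ℝ} (ht : 0 < t) (x : Set.Icc (0 : ℝ) M) :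
    resolventMap M t x = (t + (x : ℝ))⁻¹ := by
  refine ContinuousMap.mkD_apply_of_continuous ?_
  exact Continuous.inv₀ (by fun_prop) (fun x => by have := x.2.1; positivity)

/-- The error is `f(x) * x / (t + x)`, which is at most `‖f‖ * |M| / t` uniformly on `[0, M]`. This
limit recovers `L f` from the values of `L` on `f / (t + x)`. -/
theorem tendsto_smul_resolventMap (M : ℝ) (f : C(Set.Icc (0 : ℝ) M, ℝ)) :
    Tendsto (fun t : ℝ => t • (f * resolventMap M t)) atTop (𝓝 f) := by
  rw [tendsto_iff_norm_sub_tendsto_zero]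
  have hlim : Tendsto (fun t : ℝ => ‖f‖ * |M| * t⁻¹) atTop (𝓝 0) := by
    simpa using tendsto_inv_atTop_zero.const_mul (‖f‖ * |M|)
  refine squeeze_zero' (Eventually.of_forall fun _ => norm_nonneg _) ?_ hlim
  filter_upwards [eventually_gt_atTop 0] with t ht
  refine (ContinuousMap.norm_le _ (by positivity)).2 (fun x => ?_)
  have hx := x.2.1
  have hxM := x.2.2
  have hpos : 0 < t + (x : ℝ) := by positivity
  have h1 : (t • (f * resolventMap M t) - f) x = -(f x * ((x : ℝ) * (t + (x : ℝ))⁻¹)) := by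
    simp only [ContinuousMap.sub_apply, ContinuousMap.smul_apply, ContinuousMap.mul_apply,
      resolventMap_apply ht, smul_eq_mul]
    field_simp
    ring
  rw [h1, norm_neg, norm_mul, mul_assoc]
  refine mul_le_mul (f.norm_coe_le_norm x) ?_ (norm_nonneg _) (norm_nonneg _)
  rw [Real.norm_of_nonneg (by positivity)]
  have : t ≤ t + (x : ℝ) := by linarith
  refine mul_le_mul (hxM.trans (le_abs_self M)) ?_ (by positivity) (by positivity)
  gcongr

/-- A continuous linear functional on `C([0, M])` that annihilates the functions
`x ↦ (t + x)⁻¹` for arbitrarily large `t` is zero. -/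
theorem eq_zero_of_frequently_resolventMap {M : ℝ} (L : C(Set.Icc (0 : ℝ) M, ℝ) →L[ℝ] ℝ)
    (hL : ∃ᶠ t in atTop, L (resolventMap M t) = 0) : L = 0 := by
  let X : C(Set.Icc (0 : ℝ) M, ℝ) := ⟨fun x => x, continuous_subtype_val⟩
  have hlim : ∀ f : C(Set.Icc (0 : ℝ) M, ℝ),
      (∃ᶠ t in atTop, L (f * resolventMap M t) = 0) → L f = 0 := by
    intro f hf
    have h1 : Tendsto (fun t : ℝ => L (t • (f * resolventMap M t))) atTop (𝓝 (L f)) :=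
      (L.continuous.tendsto f).comp (tendsto_smul_resolventMap M f)
    refine (isClosed_singleton (x := (0 : ℝ))).mem_of_frequently_of_tendsto (s := {0}) ?_ h1
    refine hf.mono (fun t ht => ?_)
    simp [ht]
  -- The quantifier over `k ≤ n` sits inside `∃ᶠ` so that one `t` serves all `k`. In the induction
  -- the limit gives `L (X ^ n) = 0`, and then `x ^ (n + 1) / (t + x) = x ^ n - t * x ^ n / (t + x)`
  -- moves on to the next power at the same `t`.
  have hmom : ∀ n : ℕ, ∃ᶠ t in atTop, ∀ k ≤ n, L (X ^ k * resolventMap M t) = 0 := by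
    intro n
    induction n with
    | zero => simpa using hL
    | succ n ih =>
      have h0 : L (X ^ n) = 0 := hlim _ (ih.mono fun t ht => ht n le_rfl)
      refine (ih.and_eventually (eventually_gt_atTop 0)).mono ?_
      rintro t ⟨ht, htpos⟩ k hk
      rcases Nat.of_le_succ hk with hk | rfl
      · exact ht k hk
      · have h1 : X ^ (n + 1) * resolventMap M t = X ^ n - t • (X ^ n * resolventMap M t) := by
          ext x
          have hx := x.2.1
          have hpos : 0 < t + (x : ℝ) := by positivity
          simp only [ContinuousMap.sub_apply, ContinuousMap.smul_apply, ContinuousMap.mul_apply,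
            resolventMap_apply htpos, smul_eq_mul, ContinuousMap.pow_apply]
          change (x : ℝ) ^ (n + 1) * _ = (x : ℝ) ^ n - t * ((x : ℝ) ^ n * _)
          field_simp
          ring
        rw [h1, map_sub, map_smul, h0, ht n le_rfl]
        simp
  have hpow : ∀ n : ℕ, L (X ^ n) = 0 := fun n => hlim _ ((hmom n).mono fun t ht => ht n le_rfl)
  have hpoly : ∀ q : Polynomial ℝ, L (q.toContinuousMapOn (Set.Icc 0 M)) = 0 := by
    intro q
    have : q.toContinuousMapOn (Set.Icc 0 M)
        = ∑ i ∈ Finset.range (q.natDegree + 1), q.coeff i • X ^ i := by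
      ext x
      simp [Polynomial.eval_eq_sum_range, X]
    rw [this, map_sum]
    simp [hpow]
  ext f
  have hf : f ∈ closure ((polynomialFunctions (Set.Icc (0 : ℝ) M) : Subalgebra ℝ _) :
      Set C(Set.Icc (0 : ℝ) M, ℝ)) := by
    rw [← Subalgebra.topologicalClosure_coe, polynomialFunctions_closure_eq_top]
    trivial
  refine closure_minimal ?_ (isClosed_eq L.continuous continuous_const) hf
  rw [polynomialFunctions_coe]
  rintro _ ⟨q, rfl⟩
  exact hpoly q

/-- A continuous linear functional on `C([0, M])` that annihilates the constants and the function
`x ↦ x ^ p` for some `0 < p < 1`, and is nonnegative on all functions `x ↦ (t + x)⁻¹`, is zero. -/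
theorem eq_zero_of_resolventMap_nonneg {M p : ℝ} (hM : 0 ≤ M) (hp : p ∈ Set.Ioo 0 1)
    (L : C(Set.Icc (0 : ℝ) M, ℝ) →L[ℝ] ℝ) (h1 : L 1 = 0)
    (hres : ∀ t, 0 < t → 0 ≤ L (resolventMap M t))
    (hpow : L ⟨fun x => (x : ℝ) ^ p,
      Continuous.rpow_const continuous_subtype_val fun _ => Or.inr hp.1.le⟩ = 0) : L = 0 := by
  -- The integrand is treated as a `C([0, M])`-valued function of `t`, so that `L` commutes with its
  -- Bochner integral.
  let g : ℝ → C(Set.Icc (0 : ℝ) M, ℝ) := fun t =>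
    ContinuousMap.mkD ((Set.Icc (0 : ℝ) M).domRestrict (Real.rpowIntegrand₀₁ p t)) 0
  have hcont : ∀ t, 0 < t → ContinuousOn (Real.rpowIntegrand₀₁ p t) (Set.Icc 0 M) := fun t ht =>
    (Real.continuousOn_rpowIntegrand₀₁_Ici hp ht).mono (fun x hx => hx.1)
  have hg : ∀ t, 0 < t → ∀ x, g t x = Real.rpowIntegrand₀₁ p t x := fun t ht x =>
    ContinuousMap.mkD_apply_of_continuousOn (hcont t ht)
  -- The constant part of the integrand is killed by `L 1 = 0`; what remains has a fixed sign.
  have hLg : ∀ t, 0 < t → L (g t) = -(t ^ p * L (resolventMap M t)) := by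
    intro t ht
    have : g t = t ^ (p - 1) • 1 - t ^ p • resolventMap M t := by
      ext x
      rw [hg t ht, Real.rpowIntegrand₀₁_eq_sub hp.2.ne ht]
      simp [resolventMap_apply ht]
    rw [this, map_sub, map_smul, map_smul, h1]
    simp
  have hint : IntegrableOn g (Set.Ioi 0) := by
    refine ⟨ContinuousMap.aeStronglyMeasurable_restrict_mkD_restrict_of_uncurry measurableSet_Ioi
      _ _ (Real.continuousOn_rpowIntegrand₀₁_uncurry hp _ fun x hx => hx.1), ?_⟩
    refine ContinuousMap.hasFiniteIntegral_mkD_restrict_of_bound _ _ ?_ _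
      (Real.integrableOn_rpowIntegrand₀₁_Ioi hp hM).hasFiniteIntegral ?_
    · exact ae_restrict_of_forall_mem measurableSet_Ioi hcont
    · refine ae_restrict_of_forall_mem measurableSet_Ioi (fun t (ht : 0 < t) x hx => ?_)
      rw [Real.norm_of_nonneg (Real.rpowIntegrand₀₁_nonneg hp.1 ht.le hx.1)]
      exact Real.rpowIntegrand₀₁_monotoneOn hp ht.le hx.1 hM hx.2
  have hgint : ∫ t in Set.Ioi 0, g t = (∫ t in Set.Ioi 0, Real.rpowIntegrand₀₁ p t 1) •
      (⟨fun x => (x : ℝ) ^ p,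
        Continuous.rpow_const continuous_subtype_val fun _ => Or.inr hp.1.le⟩ :
        C(Set.Icc (0 : ℝ) M, ℝ)) := by
    ext x
    rw [ContinuousMap.integral_apply hint]
    rw [setIntegral_congr_fun measurableSet_Ioi (fun t ht => hg t ht x),
      Real.integral_rpowIntegrand₀₁_eq_rpow_mul_const hp x.2.1, mul_comm]
    simp
  have hL0 : ∫ t in Set.Ioi 0, -L (g t) = 0 := by
    rw [integral_neg, L.integral_comp_comm hint, hgint, map_smul, hpow]
    simp
  rw [integral_eq_zero_iff_of_nonneg_ae] at hL0
  · refine eq_zero_of_frequently_resolventMap L ?_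
    rw [Filter.EventuallyEq, ae_restrict_iff' measurableSet_Ioi] at hL0
    rw [frequently_atTop]
    intro a
    by_contra! hcon
    -- If `L` vanished on no resolvent beyond `a`, a half-line would be contained in a null set.
    have hsub : Set.Ioi (max a 0) ⊆ {t : ℝ | ¬ (t ∈ Set.Ioi 0 → -L (g t) = (0 : ℝ → ℝ) t)} := by
      intro t ht hmem
      have hta : a < t := (le_max_left _ _).trans_lt ht
      have ht0 : 0 < t := (le_max_right _ _).trans_lt ht
      have := hmem ht0
      rw [hLg t ht0, neg_neg] at this
      refine hcon t hta.le ?_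
      have hne : t ^ p ≠ 0 := (Real.rpow_pos_of_pos ht0 p).ne'
      simpa [hne] using this
    have := measure_mono_null hsub (ae_iff.1 hL0)
    simp at this
  · refine ae_restrict_of_forall_mem measurableSet_Ioi (fun t (ht : 0 < t) => ?_)
    change 0 ≤ -L (g t)
    rw [hLg t ht, neg_neg]
    exact mul_nonneg (by positivity) (hres t ht)
  · exact (L.integrable_comp hint).neg

/-! ### Cauchy–Schwarz inequalities for semispectral measures. -/

namespace SemispectralMeasure

variable {X : Type*} [MeasurableSpace X] {H : Type*}
  [NormedAddCommGroup H] [InnerProductSpace ℂ H] [CompleteSpace H]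

theorem inner_integral (F : SemispectralMeasure X H) {f : X → ℂ} (hf : F.MemL1 f) (h : H) :
    inner ℂ h (F.integral f h) = ∫ x, f x ∂(F.scalarMeasure h) := by
  rw [integral, dif_pos hf]
  exact (F.existsUnique_integral hf).choose_spec.1 h

theorem scalarMeasure_real_eq_re (F : SemispectralMeasure X H) (h : H) {s : Set X}
    (hs : MeasurableSet s) : (F.scalarMeasure h).real s = (inner ℂ h (F s h) : ℂ).re := by
  rw [← F.scalarMeasure_real h hs, Complex.ofReal_re]

theorem scalarMeasure_real_univ (F : SemispectralMeasure X H) (h : H) :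
    (F.scalarMeasure h).real Set.univ = ‖h‖ ^ 2 := by
  rw [F.scalarMeasure_real_eq_re h MeasurableSet.univ, F.univ']
  simpa using inner_self_eq_norm_sq (𝕜 := ℂ) h

/-- The real part of the sesquilinear set function `⟨F(·)h, k⟩` expressed through
scalar measures. -/
theorem scalarMeasure_add (F : SemispectralMeasure X H) (h k : H) {s : Set X}
    (hs : MeasurableSet s) : (F.scalarMeasure (h + k)).real s =
      (F.scalarMeasure h).real s + (F.scalarMeasure k).real s
        + 2 * (inner ℂ h (F s k) : ℂ).re := by
  have hsym : (inner ℂ k (F s h) : ℂ).re = (inner ℂ h (F s k) : ℂ).re := by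
    rw [← inner_conj_symm, Complex.conj_re]
    exact congrArg Complex.re ((F.isPositive' s hs).isSymmetric h k)
  simp only [F.scalarMeasure_real_eq_re _ hs, map_add, inner_add_left, inner_add_right,
    Complex.add_re, hsym]
  ring

/-- Expand `⟨F(s)(h - c k), h - c k⟩ ≥ 0` and divide by `c`. -/
theorem two_mul_re_inner_le_of_pos (F : SemispectralMeasure X H) (h k : H) {s : Set X}
    (hs : MeasurableSet s) {c : ℝ} (hc : 0 < c) :
    2 * (inner ℂ h (F s k) : ℂ).re ≤
      c⁻¹ * (F.scalarMeasure h).real s + c * (F.scalarMeasure k).real s := by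
  have h0 := F.scalarMeasure_add h (-(c : ℂ) • k) hs
  have h1 : (F.scalarMeasure (-(c : ℂ) • k)).real s = c ^ 2 * (F.scalarMeasure k).real s := by
    simp only [F.scalarMeasure_real_eq_re _ hs, map_smul, inner_smul_left, inner_smul_right]
    simp
    ring
  have h2 : (inner ℂ h (F s (-(c : ℂ) • k)) : ℂ).re = -c * (inner ℂ h (F s k) : ℂ).re := by
    rw [map_smul, inner_smul_right]
    simp
  rw [h1, h2] at h0
  have h3 : 0 ≤ (F.scalarMeasure (h + -(c : ℂ) • k)).real s := measureReal_nonneg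
  rw [h0] at h3
  have h4 := mul_nonneg (inv_pos.2 hc).le h3
  have h5 : c⁻¹ * ((F.scalarMeasure h).real s + c ^ 2 * (F.scalarMeasure k).real s
      + 2 * (-c * (inner ℂ h (F s k) : ℂ).re)) = c⁻¹ * (F.scalarMeasure h).real s
      + c * (F.scalarMeasure k).real s - 2 * (inner ℂ h (F s k) : ℂ).re := by
    field_simp
    ring
  linarith

/-- On each level set of `φ` the preceding inequality is used with `c` the value of `φ` there;
summing, the cross terms recombine to `⟨h, k⟩` because `F` is additive with total mass the identity.
-/
theorem two_mul_re_inner_le_simpleFunc (F : SemispectralMeasure X H) (h k : H)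
    (φ : SimpleFunc X ℝ) (hφ : ∀ x, 0 < φ x) :
    2 * (inner ℂ h k : ℂ).re ≤
      ∫ x, (φ x)⁻¹ ∂(F.scalarMeasure h) + ∫ x, φ x ∂(F.scalarMeasure k) := by
  have hint : ∀ l : H, Integrable φ (F.scalarMeasure l) := fun l =>
    SimpleFunc.integrable_of_isFiniteMeasure _
  have hinv : Integrable (φ.map (fun c => c⁻¹)) (F.scalarMeasure h) :=
    SimpleFunc.integrable_of_isFiniteMeasure _
  have e1 : ∫ x, (φ x)⁻¹ ∂(F.scalarMeasure h)
      = ∑ c ∈ φ.range, (F.scalarMeasure h).real (φ ⁻¹' {c}) • c⁻¹ := by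
    have : (fun x => (φ x)⁻¹) = φ.map (fun c => c⁻¹) := rfl
    rw [this, ← SimpleFunc.integral_eq_integral _ hinv, SimpleFunc.map_integral _ _ (hint h) (by simp)]
  have e2 : ∫ x, φ x ∂(F.scalarMeasure k)
      = ∑ c ∈ φ.range, (F.scalarMeasure k).real (φ ⁻¹' {c}) • c := by
    rw [SimpleFunc.integral_eq_sum _ (hint k)]
  have hsum : ∀ l : H, (F.scalarMeasure l).real Set.univ
      = ∑ c ∈ φ.range, (F.scalarMeasure l).real (φ ⁻¹' {c}) := by
    intro l
    rw [sum_measureReal_preimage_singleton _ fun c _ => SimpleFunc.measurableSet_preimage φ {c},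
      SimpleFunc.coe_range, Set.preimage_range]
  have e3 : 2 * (inner ℂ h k : ℂ).re = ∑ c ∈ φ.range, 2 * (inner ℂ h (F (φ ⁻¹' {c}) k) : ℂ).re := by
    have h0 := F.scalarMeasure_add h k MeasurableSet.univ
    rw [hsum, hsum h, hsum k, ← Finset.sum_add_distrib, F.univ'] at h0
    simp only [F.scalarMeasure_add h k (SimpleFunc.measurableSet_preimage φ _),
      Finset.sum_add_distrib] at h0
    simpa using h0.symm
  rw [e1, e2, e3, ← Finset.sum_add_distrib]
  refine Finset.sum_le_sum (fun c hc => ?_)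
  obtain ⟨x, rfl⟩ := SimpleFunc.mem_range.1 hc
  have := F.two_mul_re_inner_le_of_pos h k (SimpleFunc.measurableSet_preimage φ {φ x}) (hφ x)
  simpa [mul_comm] using this

/-- A Cauchy–Schwarz type inequality for semispectral measures. -/
theorem two_mul_re_inner_le (F : SemispectralMeasure X H) (h k : H) {y : X → ℝ}
    (hy : Measurable y) {a b : ℝ} (ha : 0 < a) (hab : ∀ x, y x ∈ Set.Icc a b) [Nonempty X] :
    2 * (inner ℂ h k : ℂ).re ≤
      ∫ x, (y x)⁻¹ ∂(F.scalarMeasure h) + ∫ x, y x ∂(F.scalarMeasure k) := by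
  have hmem : a ∈ Set.Icc a b :=
    ⟨le_rfl, (hab (Classical.arbitrary X)).1.trans (hab (Classical.arbitrary X)).2⟩
  -- Approximants with values in `[a, b]` keep both `φ n` and its reciprocal bounded, as dominated
  -- convergence requires.
  let φ : ℕ → SimpleFunc X ℝ := SimpleFunc.approxOn y hy (Set.Icc a b) a hmem
  have hφ : ∀ n x, φ n x ∈ Set.Icc a b := fun n x => SimpleFunc.approxOn_mem hy hmem n x
  have hlim : ∀ x, Tendsto (fun n => φ n x) atTop (𝓝 (y x)) := fun x =>
    SimpleFunc.tendsto_approxOn hy hmem (subset_closure (hab x))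
  have hpos : ∀ n x, 0 < φ n x := fun n x => ha.trans_le (hφ n x).1
  have l1 : Tendsto (fun n => ∫ x, (φ n x)⁻¹ ∂(F.scalarMeasure h)) atTop
      (𝓝 (∫ x, (y x)⁻¹ ∂(F.scalarMeasure h))) := by
    refine tendsto_integral_of_dominated_convergence (fun _ => a⁻¹)
      (fun n => ((φ n).measurable.inv).aestronglyMeasurable) (integrable_const _)
      (fun n => Eventually.of_forall fun x => ?_)
      (Eventually.of_forall fun x => (hlim x).inv₀ (ha.trans_le (hab x).1).ne')
    rw [Real.norm_of_nonneg (inv_nonneg.2 (hpos n x).le)]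
    exact inv_anti₀ ha (hφ n x).1
  have l2 : Tendsto (fun n => ∫ x, φ n x ∂(F.scalarMeasure k)) atTop
      (𝓝 (∫ x, y x ∂(F.scalarMeasure k))) := by
    refine tendsto_integral_of_dominated_convergence (fun _ => b)
      (fun n => (φ n).measurable.aestronglyMeasurable) (integrable_const _)
      (fun n => Eventually.of_forall fun x => ?_) (Eventually.of_forall hlim)
    rw [Real.norm_of_nonneg (hpos n x).le]
    exact (hφ n x).2
  exact ge_of_tendsto' (l1.add l2) fun n => F.two_mul_re_inner_le_simpleFunc h k (φ n) (hpos n)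

end SemispectralMeasure

/-! ### Comparison of `∫ f dF` with `f(A)`. -/

/-- Integration of a function in `C([0, M])`, extended constantly, against a finite measure. -/
noncomputable def integralFunctional {M : ℝ} (hM : 0 ≤ M) (μ : Measure NNReal)
    [IsFiniteMeasure μ] : C(Set.Icc (0 : ℝ) M, ℝ) →L[ℝ] ℝ :=
  have hint : ∀ f : C(Set.Icc (0 : ℝ) M, ℝ),
      Integrable (fun x : NNReal => f (Set.projIcc 0 M hM x)) μ := fun f =>
    Integrable.of_bound (C := ‖f‖)
      (f.continuous.comp (continuous_projIcc.comp NNReal.continuous_coe)).aestronglyMeasurable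
      (Eventually.of_forall fun x => f.norm_coe_le_norm _)
  LinearMap.mkContinuous
    { toFun := fun f => ∫ x : NNReal, f (Set.projIcc 0 M hM x) ∂μ
      map_add' := fun f g => integral_add (hint f) (hint g)
      map_smul' := fun c f => integral_const_mul c _ } (μ.real Set.univ) (fun f => by
        rw [mul_comm]
        exact norm_integral_le_of_norm_le_const (Eventually.of_forall fun x =>
          f.norm_coe_le_norm _))

theorem integralFunctional_apply {M : ℝ} (hM : 0 ≤ M) (μ : Measure NNReal)
    [IsFiniteMeasure μ] (f : C(Set.Icc (0 : ℝ) M, ℝ)) :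
    integralFunctional hM μ f = ∫ x : NNReal, f (Set.projIcc 0 M hM x) ∂μ := rfl

section

variable {H : Type*} [NormedAddCommGroup H] [InnerProductSpace ℂ H] [CompleteSpace H]

/-- The functional `f ↦ Re ⟨f(A)h, h⟩` on `C([0, M])`, where functions are extended constantly. -/
noncomputable def cfcFunctional {M : ℝ} (hM : 0 ≤ M) (A : H →L[ℂ] H) (h : H) :
    C(Set.Icc (0 : ℝ) M, ℝ) →L[ℝ] ℝ :=
  have hcont : ∀ f : C(Set.Icc (0 : ℝ) M, ℝ),
      ContinuousOn (fun x : ℝ => f (Set.projIcc 0 M hM x)) (spectrum ℝ A) := fun f =>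
    (f.continuous.comp continuous_projIcc).continuousOn
  LinearMap.mkContinuous
    { toFun := fun f => (inner ℂ h (cfc (fun x : ℝ => f (Set.projIcc 0 M hM x)) A h) : ℂ).re
      map_add' := fun f g => by
        simp only [ContinuousMap.add_apply]
        rw [cfc_add A _ _ (hcont f) (hcont g)]
        simp
      map_smul' := fun c f => by
        simp only [ContinuousMap.smul_apply]
        rw [cfc_smul c _ A (hcont f)]
        simp [inner_smul_right_eq_smul] } (‖h‖ ^ 2) (fun f => by
        have h1 : ‖cfc (fun x : ℝ => f (Set.projIcc 0 M hM x)) A‖ ≤ ‖f‖ :=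
          norm_cfc_le (norm_nonneg _) fun x _ => f.norm_coe_le_norm _
        calc _ ≤ ‖inner ℂ h (cfc (fun x : ℝ => f (Set.projIcc 0 M hM x)) A h)‖ :=
              Complex.abs_re_le_norm _
          _ ≤ ‖h‖ * (‖f‖ * ‖h‖) := (norm_inner_le_norm _ _).trans (by
              gcongr
              exact ContinuousLinearMap.le_of_opNorm_le _ h1 h)
          _ = ‖h‖ ^ 2 * ‖f‖ := by ring)

theorem cfcFunctional_apply {M : ℝ} (hM : 0 ≤ M) (A : H →L[ℂ] H) (h : H)
    (f : C(Set.Icc (0 : ℝ) M, ℝ)) : cfcFunctional hM A h f =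
      (inner ℂ h (cfc (fun x : ℝ => f (Set.projIcc 0 M hM x)) A h) : ℂ).re := rfl

namespace SemispectralMeasure

/-- If `A = ∫ x F(dx)`, then `(A + t)⁻¹ ≤ ∫ (x + t)⁻¹ F(dx)`. -/
theorem cfcFunctional_resolventMap_le (F : SemispectralMeasure NNReal H) {M : ℝ} (hM : 0 ≤ M)
    {A : H →L[ℂ] H} (hA : 0 ≤ A) (hspec : spectrum ℝ A ⊆ Set.Icc 0 M)
    (hFA : ∀ k, ∫ x : NNReal, (Set.projIcc 0 M hM x : ℝ) ∂(F.scalarMeasure k)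
      = (inner ℂ k (A k) : ℂ).re) {t : ℝ} (ht : 0 < t) (h : H) :
    cfcFunctional hM A h (resolventMap M t) ≤
      integralFunctional hM (F.scalarMeasure h) (resolventMap M t) := by
  have hsa : IsSelfAdjoint A := .of_nonneg hA
  set C : H →L[ℂ] H := cfc (fun x : ℝ => resolventMap M t (Set.projIcc 0 M hM x)) A with hC
  have hcont : ContinuousOn (fun x : ℝ => resolventMap M t (Set.projIcc 0 M hM x))
      (spectrum ℝ A) := ((resolventMap M t).continuous.comp continuous_projIcc).continuousOn
  have hinv : (t • 1 + A) * C = 1 := by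
    have e1 : t • (1 : H →L[ℂ] H) + A = cfc (fun x : ℝ => t + x) A := by
      rw [cfc_const_add t _ A, cfc_id' ℝ A, Algebra.algebraMap_eq_smul_one]
    rw [e1, hC, ← cfc_mul _ _ A (by fun_prop) hcont, ← cfc_one ℝ A]
    refine cfc_congr fun x hx => ?_
    have hx' := hspec hx
    have : 0 < t + x := by linarith [hx'.1]
    simp only [resolventMap_apply ht, Set.projIcc_of_mem hM hx', Pi.one_apply]
    field_simp
  -- With `k = (t + A)⁻¹ h` and `y = t + x`, the integral of `y` against the measure of `k` is `⟨(t
  -- + A) k, k⟩`, whose value is `Re ⟨h, k⟩`. Cancelling one copy in the Cauchy–Schwarz inequality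
  -- leaves the claim.
  set k := C h with hk
  have hk1 : t • k + A k = h := by
    have := congrArg (fun T : H →L[ℂ] H => T h) hinv
    simpa using this
  let y : NNReal → ℝ := fun x => t + (Set.projIcc 0 M hM x : ℝ)
  have hy : Measurable y := by
    refine Continuous.measurable ?_
    exact continuous_const.add (continuous_subtype_val.comp
      (continuous_projIcc.comp NNReal.continuous_coe))
  have key := F.two_mul_re_inner_le h k hy ht (b := t + M) (fun x =>
    ⟨by simpa [y] using (Set.projIcc 0 M hM x).2.1, by
      simpa [y] using (Set.projIcc 0 M hM x).2.2⟩)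
  have e2 : ∫ x, y x ∂(F.scalarMeasure k) = (inner ℂ h k : ℂ).re := by
    rw [integral_add (integrable_const _), integral_const, F.scalarMeasure_real_univ, hFA]
    · rw [show (inner ℂ h k : ℂ).re = (inner ℂ k h : ℂ).re by
        rw [← inner_conj_symm, Complex.conj_re]]
      conv_rhs => rw [← hk1]
      rw [inner_add_right, Complex.add_re, inner_smul_right_eq_smul]
      simp [← Complex.ofReal_pow, mul_comm]
    · refine Integrable.of_bound (C := M) (continuous_subtype_val.comp
        (continuous_projIcc.comp NNReal.continuous_coe)).aestronglyMeasurable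
        (Eventually.of_forall fun x => ?_)
      rw [Real.norm_of_nonneg (Set.projIcc 0 M hM x).2.1]
      exact (Set.projIcc 0 M hM x).2.2
  rw [cfcFunctional_apply, integralFunctional_apply, ← hC, ← hk]
  simp only [resolventMap_apply ht]
  simp only [y] at key e2
  linarith

/-- If `A = ∫ x F(dx)` and `A ^ p = ∫ x ^ p F(dx)` for some `0 < p < 1`, then
`f(A) = ∫ f dF` for every continuous `f`. -/
theorem integral_eq_inner_cfc (F : SemispectralMeasure NNReal H) {M : ℝ} (hM : 0 ≤ M)
    {A : H →L[ℂ] H} (hA : 0 ≤ A) (hspec : spectrum ℝ A ⊆ Set.Icc 0 M)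
    (hsupp : ∀ k, ∀ᵐ x : NNReal ∂(F.scalarMeasure k), (x : ℝ) ≤ M)
    (hFA : ∀ k, ∫ x : NNReal, (x : ℝ) ∂(F.scalarMeasure k) = (inner ℂ k (A k) : ℂ).re)
    {p : ℝ} (hp : p ∈ Set.Ioo 0 1)
    (hFp : ∀ k, ∫ x : NNReal, (x : ℝ) ^ p ∂(F.scalarMeasure k)
      = (inner ℂ k ((A ^ p) k) : ℂ).re) {f : ℝ → ℝ} (hf : Continuous f) (h : H) :
    ∫ x : NNReal, f x ∂(F.scalarMeasure h) = (inner ℂ h (cfc f A h) : ℂ).re := by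
  have hproj : ∀ (g : ℝ → ℝ) (k : H), ∫ x : NNReal, g (Set.projIcc 0 M hM x) ∂(F.scalarMeasure k)
      = ∫ x : NNReal, g x ∂(F.scalarMeasure k) := by
    intro g k
    refine integral_congr_ae ?_
    filter_upwards [hsupp k] with x hx
    rw [Set.projIcc_of_mem hM (show (x : ℝ) ∈ Set.Icc 0 M from ⟨x.2, hx⟩)]
  have hcfc : ∀ g : ℝ → ℝ, cfc (fun x : ℝ => g (Set.projIcc 0 M hM x)) A = cfc g A := by
    intro g
    refine cfc_congr fun x hx => ?_
    simp only [Set.projIcc_of_mem hM (hspec hx)]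
  have hsa : IsSelfAdjoint A := .of_nonneg hA
  -- The difference of the two functionals kills `1` since both total masses are `‖h‖ ^ 2`, is
  -- nonnegative on resolvents by Jensen, and kills `x ^ p` by `hFp`.
  have hL := eq_zero_of_resolventMap_nonneg hM hp
    (integralFunctional hM (F.scalarMeasure h) - cfcFunctional hM A h) (by
      rw [_root_.sub_apply, integralFunctional_apply, cfcFunctional_apply]
      simp only [ContinuousMap.one_apply, integral_const, F.scalarMeasure_real_univ,
        cfc_const_one ℝ A]
      simp [← Complex.ofReal_pow]) (fun t ht => by
      rw [_root_.sub_apply, sub_nonneg]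
      refine F.cfcFunctional_resolventMap_le hM hA hspec (fun k => ?_) ht h
      rw [hproj (fun x => x), hFA]) (by
      rw [_root_.sub_apply, integralFunctional_apply, cfcFunctional_apply]
      simp only [ContinuousMap.coe_mk]
      rw [hproj (fun x => x ^ p), hcfc (fun x => x ^ p), ← CFC.rpow_eq_cfc_real hA, hFp, sub_self])
  have := congrArg (fun L => L (⟨fun x => f x, hf.comp continuous_subtype_val⟩ :
    C(Set.Icc (0 : ℝ) M, ℝ))) hL
  simp only [_root_.sub_apply, integralFunctional_apply, cfcFunctional_apply,
    ContinuousMap.coe_mk] at this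
  rw [hproj f, hcfc f] at this
  simpa [sub_eq_zero] using this

end SemispectralMeasure

end

/-! ### Weak limits and multiplicativity on a π-system. -/

namespace SemispectralMeasure

section

variable {H : Type*} [NormedAddCommGroup H] [InnerProductSpace ℂ H]

theorem eq_of_inner_self {S T : H →L[ℂ] H} (h : ∀ x, inner ℂ x (S x) = inner ℂ x (T x)) :
    S = T := by
  refine ContinuousLinearMap.coe_injective ((ext_inner_map _ _).1 fun x => ?_)
  rw [← inner_conj_symm, ← inner_conj_symm (_ : H) x]
  exact congrArg _ (h x)

/-- Convergence of the quadratic forms implies weak convergence of the operators. -/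
theorem tendsto_inner_of_tendsto_inner_self {ι : Type*} {l : Filter ι} {T : ι → H →L[ℂ] H}
    {S : H →L[ℂ] H} (hT : ∀ x, Tendsto (fun i => inner ℂ x (T i x)) l (𝓝 (inner ℂ x (S x))))
    (x y : H) : Tendsto (fun i => inner ℂ x (T i y)) l (𝓝 (inner ℂ x (S y))) := by
  have hT' : ∀ x, Tendsto (fun i => inner ℂ (T i x) x) l (𝓝 (inner ℂ (S x) x)) := by
    intro x
    rw [← inner_conj_symm]
    exact ((Complex.continuous_conj.tendsto _).comp (hT x)).congr fun n => inner_conj_symm _ _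
  have h1 := (((((hT' (y + x)).sub (hT' (y - x))).sub
    ((hT' (y + Complex.I • x)).const_mul Complex.I)).add
    ((hT' (y - Complex.I • x)).const_mul Complex.I)).div_const 4)
  have h2 : Tendsto (fun i => inner ℂ (T i y) x) l (𝓝 (inner ℂ (S y) x)) := by
    have e := inner_map_polarization' (S : H →ₗ[ℂ] H) y x
    simp only [ContinuousLinearMap.coe_coe] at e
    rw [e]
    exact h1.congr fun n => (inner_map_polarization' (T n : H →ₗ[ℂ] H) y x).symm
  rw [← inner_conj_symm]
  exact ((Complex.continuous_conj.tendsto _).comp h2).congr fun n => inner_conj_symm _ _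

end

section

variable {X : Type*} [MeasurableSpace X] {H : Type*}
  [NormedAddCommGroup H] [InnerProductSpace ℂ H] [CompleteSpace H]

theorem apply_eq_of_real (F : SemispectralMeasure X H) {s : Set X} (hs : MeasurableSet s)
    {T : H →L[ℂ] H} (h : ∀ x, (((F.scalarMeasure x).real s : ℝ) : ℂ) = inner ℂ x (T x)) :
    F s = T :=
  eq_of_inner_self fun x => by rw [← F.scalarMeasure_real x hs, h]

theorem apply_inter_compl (F : SemispectralMeasure X H) {s t : Set X} (hs : MeasurableSet s)
    (ht : MeasurableSet t) : F (s ∩ tᶜ) = F s - F (s ∩ t) := by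
  refine F.apply_eq_of_real (hs.inter ht.compl) fun x => ?_
  rw [_root_.sub_apply, inner_sub_right, ← F.scalarMeasure_real x hs,
    ← F.scalarMeasure_real x (hs.inter ht), ← Complex.ofReal_sub, ← Set.sdiff_eq,
    ← measureReal_inter_add_sdiff (s := s) ht, add_sub_cancel_left]

theorem apply_empty (F : SemispectralMeasure X H) : F ∅ = 0 :=
  F.apply_eq_of_real MeasurableSet.empty fun x => by simp

theorem inner_apply_left (F : SemispectralMeasure X H) {s : Set X} (hs : MeasurableSet s)
    (x y : H) : inner ℂ (F s x) y = inner ℂ x (F s y) :=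
  (F.isPositive' s hs).isSymmetric x y

/-- Polarization turns convergence of the quadratic forms of the partial sums into convergence of
the sesquilinear forms. -/
theorem hasSum_inner (F : SemispectralMeasure X H) {s : ℕ → Set X}
    (hs : ∀ n, MeasurableSet (s n)) (hd : Pairwise (Function.onFun Disjoint s)) (x y : H) :
    HasSum (fun n => inner ℂ x (F (s n) y)) (inner ℂ x (F (⋃ n, s n) y)) := by
  have := tendsto_inner_of_tendsto_inner_self (l := atTop)
    (T := fun I : Finset ℕ => ∑ n ∈ I, F (s n)) (S := F (⋃ n, s n)) (fun z => by
      have := F.hasSum_iUnion' s hs hd z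
      simpa [HasSum, inner_sum] using this) x y
  simpa [HasSum, inner_sum] using this

/-- For a fixed measurable set `s`, multiplicativity `F (s ∩ t) = F s * F t` extends from
a generating π-system to all measurable sets `t`. -/
theorem apply_inter_of_isPiSystem (F : SemispectralMeasure X H) {𝒞 : Set (Set X)}
    (hgen : ‹MeasurableSpace X› = MeasurableSpace.generateFrom 𝒞) (hpi : IsPiSystem 𝒞)
    {s : Set X} (hs : MeasurableSet s) (h : ∀ t ∈ 𝒞, F (s ∩ t) = F s * F t)
    {t : Set X} (ht : MeasurableSet t) : F (s ∩ t) = F s * F t := by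
  induction t, ht using MeasurableSpace.induction_on_inter hgen hpi with
  | empty => simp [F.apply_empty]
  | basic t ht => exact h t ht
  | compl t ht ih =>
    have := F.apply_inter_compl MeasurableSet.univ ht
    rw [Set.univ_inter, Set.univ_inter, F.univ'] at this
    rw [F.apply_inter_compl hs ht, ih, this, mul_sub, mul_one]
  | iUnion t hd ht ih =>
    refine eq_of_inner_self fun x => ?_
    rw [Set.inter_iUnion]
    refine (F.hasSum_iUnion' (fun n => s ∩ t n) (fun n => hs.inter (ht n))
      (fun i j hij => (hd hij).mono Set.inter_subset_right Set.inter_subset_right) x).unique ?_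
    simp only [ih]
    -- Moving `F s` to the left argument leaves a form in two different vectors, `F s x` and `x`,
    -- which is why `hasSum_inner` is needed.
    simpa only [mul_apply_eq_comp, ← F.inner_apply_left hs] using F.hasSum_inner ht hd (F s x) x

/-- A semispectral measure which is multiplicative on closed sets is spectral. -/
theorem isSpectral_of_isClosed [TopologicalSpace X] [BorelSpace X] (F : SemispectralMeasure X H)
    (h : ∀ s t, IsClosed s → IsClosed t → F (s ∩ t) = F s * F t) : F.IsSpectral := by
  have hgen : ‹MeasurableSpace X› = MeasurableSpace.generateFrom {s : Set X | IsClosed s} := by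
    rw [BorelSpace.measurable_eq (α := X), borel_eq_generateFrom_isClosed]
  have hpi : IsPiSystem {s : Set X | IsClosed s} := isPiSystem_isClosed
  have hadj : ∀ s, MeasurableSet s → IsSelfAdjoint (F s) := fun s hs =>
    (F.isPositive' s hs).isSelfAdjoint
  have h1 : ∀ s t, IsClosed s → MeasurableSet t → F (s ∩ t) = F s * F t := fun s t hs ht =>
    F.apply_inter_of_isPiSystem hgen hpi hs.measurableSet (fun t ht => h s t hs ht) ht
  intro s hs
  refine ⟨?_, hadj s hs⟩
  -- Adjoints of `h1` exchange the factors, giving the product rule for arbitrary `s` and closed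
  -- `t`. A second extension frees `t`, and `t = s` gives idempotence.
  have h2 := F.apply_inter_of_isPiSystem hgen hpi hs (fun t ht => by
    have h3 := congrArg star (h1 t s ht hs)
    rwa [star_mul, (hadj s hs).star_eq, (hadj t ht.measurableSet).star_eq,
      (hadj _ (ht.measurableSet.inter hs)).star_eq, Set.inter_comm] at h3) hs
  rw [Set.inter_self] at h2
  exact h2.symm

end

end SemispectralMeasure

/-! ### From the functional calculus to projections. -/

/-- A sequence of thickened indicators decreasing to the indicator of a closed set. -/
noncomputable def thickenedIndicatorSeq {X : Type*} [PseudoEMetricSpace X] (C : Set X) (n : ℕ) :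
    X → ℝ := fun x => (thickenedIndicator (Nat.one_div_pos_of_nat (α := ℝ) (n := n)) C x : ℝ)

theorem continuous_thickenedIndicatorSeq {X : Type*} [PseudoEMetricSpace X] (C : Set X) (n : ℕ) :
    Continuous (thickenedIndicatorSeq C n) :=
  NNReal.continuous_coe.comp (thickenedIndicator _ C).continuous

theorem abs_thickenedIndicatorSeq_le {X : Type*} [PseudoEMetricSpace X] (C : Set X) (n : ℕ)
    (x : X) : |thickenedIndicatorSeq C n x| ≤ 1 := by
  rw [thickenedIndicatorSeq, abs_of_nonneg (NNReal.coe_nonneg _)]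
  exact_mod_cast thickenedIndicator_le_one _ C x

theorem tendsto_integral_mul_thickenedIndicatorSeq {X : Type*} [PseudoEMetricSpace X]
    [MeasurableSpace X] [BorelSpace X] (μ : Measure X) [IsFiniteMeasure μ] {C : Set X}
    (hC : IsClosed C) {w : X → ℝ} (hw : Measurable w) (hw1 : ∀ x, |w x| ≤ 1) :
    Tendsto (fun n => ∫ x, w x * thickenedIndicatorSeq C n x ∂μ) atTop (𝓝 (∫ x in C, w x ∂μ)) := by
  rw [← integral_indicator hC.measurableSet]
  refine tendsto_integral_of_dominated_convergence (fun _ => 1)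
    (fun n => (hw.mul (continuous_thickenedIndicatorSeq C n).measurable).aestronglyMeasurable)
    (integrable_const _) (fun n => Eventually.of_forall fun x => ?_)
    (Eventually.of_forall fun x => ?_)
  · rw [Real.norm_eq_abs, abs_mul]
    exact mul_le_one₀ (hw1 x) (abs_nonneg _) (abs_thickenedIndicatorSeq_le C n x)
  · have h1 := tendsto_pi_nhds.1 (thickenedIndicator_tendsto_indicator_closure
      (fun n => Nat.one_div_pos_of_nat (α := ℝ) (n := n)) tendsto_one_div_add_atTop_nhds_zero_nat
      C) x
    have h2 := ((NNReal.continuous_coe.tendsto _).comp h1).const_mul (w x)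
    rw [hC.closure_eq] at h2
    have h3 : C.indicator w x = w x * ((C.indicator (fun _ => (1 : NNReal)) x : NNReal) : ℝ) := by
      by_cases hx : x ∈ C <;> simp [hx]
    rw [h3]
    exact h2

namespace SemispectralMeasure

variable {H : Type*} [NormedAddCommGroup H] [InnerProductSpace ℂ H] [CompleteSpace H]

/-- If integration against `F` is given by the functional calculus of an operator, then `F` is
spectral. -/
theorem isSpectral_of_integral_eq_cfc (F : SemispectralMeasure NNReal H) (A : H →L[ℂ] H)
    (hA : ∀ f : ℝ → ℝ, Continuous f → ∀ h,
      ∫ x : NNReal, f x ∂(F.scalarMeasure h) = (inner ℂ h (cfc f A h) : ℂ).re) :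
    F.IsSpectral := by
  have hsymm : ∀ (f : ℝ → ℝ) (x y : H), inner ℂ (cfc f A x) y = inner ℂ x (cfc f A y) :=
    fun f x y => (IsSelfAdjoint.isSymmetric (cfc_predicate f A)) x y
  have hA' : ∀ f : ℝ → ℝ, Continuous f → ∀ h,
      ((∫ x : NNReal, f x ∂(F.scalarMeasure h) : ℝ) : ℂ) = inner ℂ h (cfc f A h) := by
    intro f hf h
    rw [hA f hf h]
    refine Complex.conj_eq_iff_re.1 ?_
    rw [inner_conj_symm, hsymm]
  -- `cfc` takes functions on `ℝ`, so the indicators are extended through `Real.toNNReal`, which is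
  -- the identity on the nonnegative reals.
  let u : Set NNReal → ℕ → ℝ → ℝ := fun C n x => thickenedIndicatorSeq C n x.toNNReal
  have hu : ∀ C n, Continuous (u C n) := fun C n =>
    (continuous_thickenedIndicatorSeq C n).comp continuous_real_toNNReal
  have hweak : ∀ C, IsClosed C → ∀ x y,
      Tendsto (fun n => inner ℂ x (cfc (u C n) A y)) atTop (𝓝 (inner ℂ x (F C y))) := by
    intro C hC
    refine tendsto_inner_of_tendsto_inner_self fun h => ?_
    rw [← F.scalarMeasure_real h hC.measurableSet]
    have h1 := tendsto_integral_mul_thickenedIndicatorSeq (F.scalarMeasure h) hC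
      (w := fun _ => 1) measurable_const (by simp)
    have h2 := (Complex.continuous_ofReal.tendsto _).comp h1
    simp only [setIntegral_const, smul_eq_mul, mul_one, one_mul] at h2
    refine h2.congr fun n => ?_
    rw [← hA' _ (hu C n)]
    simp [u]
  refine F.isSpectral_of_isClosed fun C D hC hD => ?_
  -- The double limit is iterated: here the approximation of `D` is sent to its limit with `n`
  -- fixed, using `cfc_mul`; the approximation of `C` follows afterwards.
  have hstep : ∀ n h, ((∫ x in D, thickenedIndicatorSeq C n x ∂(F.scalarMeasure h) : ℝ) : ℂ)
      = inner ℂ (cfc (u C n) A h) (F D h) := by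
    intro n h
    refine tendsto_nhds_unique ?_ (hweak D hD (cfc (u C n) A h) h)
    have h1 := (Complex.continuous_ofReal.tendsto _).comp
      (tendsto_integral_mul_thickenedIndicatorSeq (F.scalarMeasure h) hD
        (continuous_thickenedIndicatorSeq C n).measurable (abs_thickenedIndicatorSeq_le C n))
    refine h1.congr fun m => ?_
    rw [hsymm, ← mul_apply_eq_comp, ← cfc_mul _ _ A (hu C n).continuousOn
      (hu D m).continuousOn, ← hA' (fun x => u C n x * u D m x) ((hu C n).mul (hu D m))]
    simp [u]
  refine F.apply_eq_of_real (hC.inter hD).measurableSet fun h => ?_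
  rw [mul_apply_eq_comp, ← F.inner_apply_left hC.measurableSet]
  have h1 := (Complex.continuous_ofReal.tendsto _).comp
    (tendsto_integral_mul_thickenedIndicatorSeq ((F.scalarMeasure h).restrict D) hC
      (w := fun _ => 1) measurable_const (by simp))
  have h2 : Tendsto (fun n => inner ℂ (cfc (u C n) A h) (F D h)) atTop
      (𝓝 (inner ℂ (F C h) (F D h))) := by
    rw [F.inner_apply_left hC.measurableSet]
    exact (hweak C hC h (F D h)).congr fun n => (hsymm _ _ _).symm
  refine tendsto_nhds_unique ?_ h2
  simp only [setIntegral_const, smul_eq_mul, mul_one, one_mul,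
    measureReal_restrict_apply hC.measurableSet] at h1
  exact h1.congr fun n => hstep n h

end SemispectralMeasure

/-! ### Images, supports and the reduction to exponents below one. -/

namespace SemispectralMeasure

section

variable {X Y : Type*} [MeasurableSpace X] [MeasurableSpace Y] {H : Type*}
  [NormedAddCommGroup H] [InnerProductSpace ℂ H] [CompleteSpace H]

/-- The image of a semispectral measure under a measurable map. -/
def map (F : SemispectralMeasure X H) {g : X → Y} (hg : Measurable g) :
    SemispectralMeasure Y H where
  toFun s := F (g ⁻¹' s)
  isPositive' s hs := F.isPositive' _ (hg hs)
  hasSum_iUnion' s hs hd h := by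
    rw [Set.preimage_iUnion]
    exact F.hasSum_iUnion' _ (fun n => hg (hs n)) (fun i j hij => (hd hij).preimage g) h
  univ' := by rw [Set.preimage_univ, F.univ']

theorem map_apply (F : SemispectralMeasure X H) {g : X → Y} (hg : Measurable g) (s : Set Y) :
    F.map hg s = F (g ⁻¹' s) := rfl

theorem scalarMeasure_map (F : SemispectralMeasure X H) {g : X → Y} (hg : Measurable g) (h : H) :
    (F.map hg).scalarMeasure h = (F.scalarMeasure h).map g := by
  ext s hs
  rw [scalarMeasure_apply _ _ hs, Measure.map_apply hg hs, scalarMeasure_apply _ _ (hg hs),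
    map_apply]

/-- The support carries the semispectral measure. -/
theorem ae_mem_support [TopologicalSpace X] [SecondCountableTopology X] [OpensMeasurableSpace X]
    (F : SemispectralMeasure X H) (h : H) : ∀ᵐ x ∂(F.scalarMeasure h), x ∈ F.support := by
  rw [ae_iff]
  refine measure_null_of_locally_null _ (fun x hx => ?_)
  simp only [support, Set.mem_ofPred_eq, not_forall, not_not] at hx
  obtain ⟨U, hU, hxU, hFU⟩ := hx
  refine ⟨U, mem_nhdsWithin_of_mem_nhds (hU.mem_nhds hxU), ?_⟩
  rw [F.scalarMeasure_apply h hU.measurableSet, hFU]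
  simp

theorem integral_ofReal_eq_re_inner (F : SemispectralMeasure X H) {f : X → ℝ} (hf : Measurable f)
    (hint : ∀ h, Integrable f (F.scalarMeasure h)) (h : H) :
    ((∫ x, f x ∂(F.scalarMeasure h) : ℝ) : ℂ) = inner ℂ h (F.integral (fun x => (f x : ℂ)) h) := by
  rw [F.inner_integral (f := fun x => (f x : ℂ)) ⟨Complex.measurable_ofReal.comp hf, fun h => (hint h).ofReal⟩,
    integral_complex_ofReal]

theorem integral_nonneg_of_nonneg (F : SemispectralMeasure X H) {f : X → ℝ} (hf : Measurable f)
    (hint : ∀ h, Integrable f (F.scalarMeasure h)) (h0 : ∀ x, 0 ≤ f x) :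
    0 ≤ F.integral (fun x => (f x : ℂ)) := by
  rw [ContinuousLinearMap.nonneg_iff_isPositive, ContinuousLinearMap.isPositive_iff_complex]
  intro h
  rw [← inner_conj_symm, ← F.integral_ofReal_eq_re_inner hf hint, Complex.conj_ofReal]
  exact ⟨by simp, by simpa using integral_nonneg h0⟩

end

variable {H : Type*} [NormedAddCommGroup H] [InnerProductSpace ℂ H] [CompleteSpace H]

theorem isSpectral_of_rpow_lt_one (F : SemispectralMeasure NNReal H) {M : ℝ}
    {A : H →L[ℂ] H} (hA : 0 ≤ A) (hsupp : ∀ k, ∀ᵐ x : NNReal ∂(F.scalarMeasure k), (x : ℝ) ≤ M)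
    (hFA : ∀ k, ∫ x : NNReal, (x : ℝ) ∂(F.scalarMeasure k) = (inner ℂ k (A k) : ℂ).re)
    {p : ℝ} (hp : p ∈ Set.Ioo 0 1)
    (hFp : ∀ k, ∫ x : NNReal, (x : ℝ) ^ p ∂(F.scalarMeasure k)
      = (inner ℂ k ((A ^ p) k) : ℂ).re) : F.IsSpectral := by
  -- `[0, N]` must contain both the support of `F` and the spectrum of `A`; the factor `‖1‖` covers
  -- the trivial space, where it is `0`.
  let N : ℝ := max M (‖A‖ * ‖(1 : H →L[ℂ] H)‖)
  have hN : 0 ≤ N := (by positivity : 0 ≤ ‖A‖ * ‖(1 : H →L[ℂ] H)‖).trans (le_max_right _ _)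
  refine F.isSpectral_of_integral_eq_cfc A fun f hf h => ?_
  refine F.integral_eq_inner_cfc hN hA (fun x hx => ?_)
    (fun k => (hsupp k).mono fun x hx => hx.trans (le_max_left _ _)) hFA hp hFp hf h
  refine ⟨spectrum_nonneg_of_nonneg hA hx, (le_abs_self x).trans ?_⟩
  exact (spectrum.norm_le_norm_mul_of_mem hx).trans (le_max_right _ _)

/-- Every measurable `s` equals `g ⁻¹' (g' ⁻¹' s)`, so each value of `F` is a value of its image. -/
theorem isSpectral_of_map (F : SemispectralMeasure NNReal H) {g : NNReal → NNReal}
    (hg : Measurable g) {g' : NNReal → NNReal} (hg' : Measurable g')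
    (hgg' : Function.LeftInverse g' g) (h : (F.map hg).IsSpectral) : F.IsSpectral := by
  intro s hs
  have := h _ (hg' hs)
  rwa [map_apply, ← Set.preimage_comp, hgg'.comp_eq_id, Set.preimage_id] at this

end SemispectralMeasure

theorem lemma4p3 {H : Type*} [NormedAddCommGroup H] [InnerProductSpace ℂ H] [CompleteSpace H]
    (F : SemispectralMeasure NNReal H) (hF : F.HasCompactSupport)
    (p : ℝ) (hp : 0 < p) (hp1 : p ≠ 1)
    (hFp : (F.integral (fun x : NNReal => ((x : ℝ) : ℂ))) ^ p
      = F.integral (fun x : NNReal => (((x : ℝ) ^ p : ℝ) : ℂ))) :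
    F.IsSpectral := by
  obtain ⟨M, hM⟩ := hF.bddAbove
  have hsupp : ∀ k, ∀ᵐ x : NNReal ∂(F.scalarMeasure k), x ≤ M := fun k =>
    (F.ae_mem_support k).mono fun x hx => hM hx
  have hpowle : ∀ k, ∀ᵐ x : NNReal ∂(F.scalarMeasure k), (x : ℝ) ^ p ≤ (M : ℝ) ^ p := fun k =>
    (hsupp k).mono fun x hx => Real.rpow_le_rpow x.2 (by exact_mod_cast hx) hp.le
  have hmeas : Measurable fun x : NNReal => (x : ℝ) := measurable_coe_nnreal_real
  have hmeasp : Measurable fun x : NNReal => (x : ℝ) ^ p := hmeas.pow_const p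
  have hint : ∀ k, Integrable (fun x : NNReal => (x : ℝ)) (F.scalarMeasure k) := fun k =>
    Integrable.of_bound (C := (M : ℝ)) hmeas.aestronglyMeasurable ((hsupp k).mono fun x hx => by
      simpa using hx)
  have hintp : ∀ k, Integrable (fun x : NNReal => (x : ℝ) ^ p) (F.scalarMeasure k) := fun k =>
    Integrable.of_bound (C := (M : ℝ) ^ p) hmeasp.aestronglyMeasurable
      ((hpowle k).mono fun x hx => by
        rwa [Real.norm_of_nonneg (Real.rpow_nonneg x.coe_nonneg p)])
  set A := F.integral (fun x : NNReal => ((x : ℝ) : ℂ)) with hAdef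
  have hA : 0 ≤ A := F.integral_nonneg_of_nonneg hmeas hint fun x => x.2
  have h1 : ∀ k, ∫ x : NNReal, (x : ℝ) ∂(F.scalarMeasure k) = (inner ℂ k (A k) : ℂ).re := by
    intro k
    rw [hAdef, ← F.integral_ofReal_eq_re_inner hmeas hint, Complex.ofReal_re]
  have h2 : ∀ k, ∫ x : NNReal, (x : ℝ) ^ p ∂(F.scalarMeasure k)
      = (inner ℂ k ((A ^ p) k) : ℂ).re := by
    intro k
    rw [hFp, ← F.integral_ofReal_eq_re_inner hmeasp hintp, Complex.ofReal_re]
  rcases hp1.lt_or_gt with hlt | hgt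
  · exact F.isSpectral_of_rpow_lt_one hA (M := M)
      (fun k => (hsupp k).mono fun x hx => by exact_mod_cast hx) h1 ⟨hp, hlt⟩ h2
  · have hg : Measurable fun x : NNReal => x ^ p := measurable_id.pow_const p
    have hg' : Measurable fun x : NNReal => x ^ p⁻¹ := measurable_id.pow_const p⁻¹
    refine F.isSpectral_of_map hg hg' (fun x => NNReal.rpow_rpow_inv hp.ne' x) ?_
    -- The image measure has first moment `∫ x ^ p dF = A ^ p`, and its moment of order `p⁻¹` is `∫
    -- x dF = A = (A ^ p) ^ p⁻¹`.
    refine (F.map hg).isSpectral_of_rpow_lt_one (M := (M : ℝ) ^ p) (A := A ^ p) (p := p⁻¹)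
      CFC.rpow_nonneg (fun k => ?_) (fun k => ?_) ⟨inv_pos.2 hp, inv_lt_one_of_one_lt₀ hgt⟩
      (fun k => ?_)
    · rw [F.scalarMeasure_map hg, ae_map_iff hg.aemeasurable
        (measurableSet_le hmeas measurable_const)]
      simpa only [NNReal.coe_rpow] using hpowle k
    · rw [F.scalarMeasure_map hg, integral_map hg.aemeasurable hmeas.aestronglyMeasurable, ← h2]
      simp only [NNReal.coe_rpow]
    · rw [F.scalarMeasure_map hg, integral_map hg.aemeasurable
        (hmeas.pow_const p⁻¹).aestronglyMeasurable,
        CFC.rpow_rpow_of_exponent_nonneg A p p⁻¹ hp.le (inv_pos.2 hp).le hA,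
        mul_inv_cancel₀ hp.ne', CFC.rpow_one A hA, ← h1]
      refine integral_congr_ae (Eventually.of_forall fun x => ?_)
      simp only [NNReal.coe_rpow]
      exact Real.rpow_rpow_inv x.2 hp.ne'
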